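/- Let $n\ge 6$ be even and let $C_n$ be the cycle with vertices $v_1,\dots,v_n$ in cyclic order (so $v_i$ is adjacent to $v_{i+1}$ for $1\le i<n$, and $v_n$ to $v_1$). For a permutation $\pi$ of $\{1,\dots,n\}$, place for each $i$ a pebble $p_i$, with destination $v_i$, at the vertex $v_{\pi(i)}$. In one round one selects a matching of $C_n$ and, for each edge of the matching, swaps the two pebbles at its endpoints. Let $rt(C_n,\pi)$ be the minimum number of rounds after which every pebble can be at its destination. If $rt(C_n,\pi)=n-1$, then $\pi$ is the rotation $(1\,2\,\cdots\,n)$ or its inverse. -/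

import Mathlib

/-- `σ` is the permutation of the vertices of `G` which exchanges the two endpoints of every edge
of some matching `M` of `G` (possibly empty) and fixes all vertices not covered by `M`. -/
def IsMatchingSwap {V : Type*} (G : SimpleGraph V) (σ : Equiv.Perm V) : Prop :=
  ∃ M : G.Subgraph, M.IsMatching ∧
    (∀ u v : V, M.Adj u v → σ u = v) ∧ (∀ v : V, v ∉ M.verts → σ v = v)

/-- A placement of the pebbles is a permutation `p` of the vertex labels: pebble `i`, whose
destination is the vertex `i`, sits at the vertex `p i`.
`RoutesIn G π k` says that, from the placement `π`, all pebbles can be brought to their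
destinations in `k` rounds, where in each round the pebbles at the endpoints of each edge
of a matching are swapped; `p t` is the placement after `t` rounds. -/
def RoutesIn {V : Type*} (G : SimpleGraph V) (π : Equiv.Perm V) (k : ℕ) : Prop :=
  ∃ p : ℕ → Equiv.Perm V, p 0 = π ∧
    (∀ t < k, ∃ σ : Equiv.Perm V, IsMatchingSwap G σ ∧ ∀ i : V, p (t + 1) i = σ (p t i)) ∧
    ∀ i : V, p k i = i

/-- The routing number `rt(G, π)`: the minimum number of rounds needed to route `π` on `G`
(`⊤` if `π` cannot be routed on `G` at all). -/
noncomputable def routingNumber {V : Type*} (G : SimpleGraph V) (π : Equiv.Perm V) : ℕ∞ :=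
  ⨅ (k : ℕ) (_ : RoutesIn G π k), (k : ℕ∞)

/-! Lift the cycle to `ℤ`. The destinations of the pebbles become a map `d` with `d (x + n) = d x +
n`, where the displacement `d x - x` is free modulo `n` subject to total displacement zero. As `n`
is even, odd-even transposition sort on `ℤ` is `n`-periodic and each of its rounds descends to a
matching of the cycle. It therefore suffices to choose a lift and a starting parity for which the
sort ends within `n - 2` rounds.

For a threshold `c`, let the height of a bond count the values at most `c` to its right. Heights
evolve by a max-plus rule, and a light-cone estimate reduces sortedness after `T` rounds to an
initial bound: `∑ |cutTerm|` over residue classes is at most `T` at the bonds of one parity inside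
the cone (`IsAffinePerm.oddEvenSort_eq_id`).

If the displacement is not constant modulo `n`, take a lift minimising the sum of squared
displacements. Displacements then differ by at most `n`, and ties at exactly `n` are broken by the
position within a run of equal displacement modulo `n`. A cut with sum above `n - 2` must then be
saturated. Saturated cuts at bonds of both parities would, up to a period, share a window and sit at
adjacent bonds, which determines `d` so closely that the tie-break is violated
(`not_saturatedCut_succ`). Hence one parity works.

If the displacement is constant modulo `n`, the permutation is a rotation by some `k`. For `2 ≤ k ≤
n - 2` the explicit `rotationLift` works, and `k = 0` needs no rounds. Only `k = 1` and `k = n - 1`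
remain. -/

/-- An affine permutation of `ℤ` of period `n`, with vanishing total displacement over a period. -/
structure IsAffinePerm (n : ℕ) (d : ℤ → ℤ) : Prop where
  shift : ∀ x, d (x + n) = d x + n
  inj : ∀ x y, (n : ℤ) ∣ d x - d y → (n : ℤ) ∣ x - y
  sum : ∑ j ∈ Finset.range n, d j = ∑ j ∈ Finset.range n, (j : ℤ)

/-! ### Odd-even sort and the evolution of heights. -/

/-- Odd-even transposition sort on `ℤ`: in round `t` the bonds `{x, x + 1}` with `x + t + ε` even
are compared and the smaller value is moved to the left. -/
def oddEvenSort (ε : ℤ) (d : ℤ → ℤ) : ℕ → ℤ → ℤ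
  | 0 => d
  | t + 1 => fun x =>
    if (x + t + ε) % 2 = 0 then min (oddEvenSort ε d t x) (oddEvenSort ε d t (x + 1))
    else max (oddEvenSort ε d t (x - 1)) (oddEvenSort ε d t x)

theorem oddEvenSort_succ_left {ε : ℤ} {d : ℤ → ℤ} {t : ℕ} {x : ℤ} (h : (x + t + ε) % 2 = 0) :
    oddEvenSort ε d (t + 1) x = min (oddEvenSort ε d t x) (oddEvenSort ε d t (x + 1)) :=
  if_pos h

theorem oddEvenSort_succ_right {ε : ℤ} {d : ℤ → ℤ} {t : ℕ} {x : ℤ} (h : ¬ (x + t + ε) % 2 = 0) :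
    oddEvenSort ε d (t + 1) x = max (oddEvenSort ε d t (x - 1)) (oddEvenSort ε d t x) :=
  if_neg h

/-- The evolution under `oddEvenSort` of the number of small values to the right of a bond. -/
def heightFlow (ε : ℤ) (h : ℤ → ℤ) : ℕ → ℤ → ℤ
  | 0 => h
  | t + 1 => fun x =>
    if (x + t + ε) % 2 = 0 then max (heightFlow ε h t (x - 1) - 1) (heightFlow ε h t (x + 1))
    else heightFlow ε h t x

/-- Only whether a value exceeds `c` matters, so the sort projects to a 0-1 sort. There a compared
bond loses one unit of height exactly when it has a small value on its right and a large one on its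
left, which is the max rule. -/
theorem heightFlow_step (ε c : ℤ) (d h : ℤ → ℤ)
    (hd : ∀ x, h (x - 1) - h x = if d x ≤ c then 1 else 0) (t : ℕ) (x : ℤ) :
    heightFlow ε h t (x - 1) - heightFlow ε h t x =
      if oddEvenSort ε d t x ≤ c then 1 else 0 := by
  induction t generalizing x with
  | zero => exact hd x
  | succ t ih =>
    have h1 := ih x
    have h2 := ih (x + 1)
    have h3 := ih (x - 1)
    rw [show x + 1 - 1 = x by ring] at h2
    simp only [heightFlow]
    by_cases hx : (x + t + ε) % 2 = 0
    · have hx' : ¬ (x - 1 + t + ε) % 2 = 0 := by omega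
      rw [oddEvenSort_succ_left hx, if_pos hx, if_neg hx']
      split_ifs at h1 h2 ⊢ <;> omega
    · have hx' : (x - 1 + t + ε) % 2 = 0 := by omega
      rw [oddEvenSort_succ_right hx, if_neg hx, if_pos hx', show x - 1 + 1 = x by ring]
      split_ifs at h1 h3 ⊢ <;> omega

theorem heightFlow_nonneg (ε : ℤ) (h : ℤ → ℤ) (h0 : ∀ x, 0 ≤ h x) (t : ℕ) (x : ℤ) :
    0 ≤ heightFlow ε h t x := by
  induction t generalizing x with
  | zero => exact h0 x
  | succ t ih =>
    simp only [heightFlow]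
    have := ih (x + 1)
    have := ih x
    split_ifs <;> omega

/-- The quantity `h x + x - c` is the dual height, which counts the values above `c` to the left of
the bond. -/
theorem heightFlow_add_nonneg (ε c : ℤ) (h : ℤ → ℤ) (h0 : ∀ x, 0 ≤ h x + x - c) (t : ℕ) (x : ℤ) :
    0 ≤ heightFlow ε h t x + x - c := by
  induction t generalizing x with
  | zero => exact h0 x
  | succ t ih =>
    simp only [heightFlow]
    have := ih (x - 1)
    have := ih x
    split_ifs <;> omega

/-- Backward light cone of the bond `c` at time `T`: an updated bond reads only its two neighbours,
and the linear bound is chosen so that both branches of the max give the same estimate one round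
later. -/
theorem heightFlow_le (ε c : ℤ) (T : ℕ) (h : ℤ → ℤ)
    (hb : ∀ z, (z + ε) % 2 = 1 → |z - c| ≤ T → 2 * h z ≤ T + c - z) (t : ℕ) (ht : t ≤ T) (z : ℤ)
    (hz : (z + t + ε) % 2 = 1) (hzc : |z - c| ≤ T - t) :
    2 * heightFlow ε h t z ≤ T - t + c - z := by
  induction t generalizing z with
  | zero =>
    have := hb z (by simpa using hz) (by simpa using hzc)
    simpa [heightFlow] using this
  | succ t ih =>
    push_cast at hz hzc ⊢
    rw [abs_le] at hzc
    have h1 := ih (by omega) (z - 1) (by omega) (by rw [abs_le]; omega)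
    have h2 := ih (by omega) (z + 1) (by omega) (by rw [abs_le]; omega)
    simp only [heightFlow]
    rw [if_pos (by omega)]
    omega

theorem heightFlow_final (ε c : ℤ) (T : ℕ) (hT : 0 < T) (h : ℤ → ℤ)
    (hb : ∀ z, (z + ε) % 2 = 1 → |z - c| ≤ T → 2 * h z ≤ T + c - z) :
    heightFlow ε h T c ≤ 0 := by
  by_cases hc : (c + T + ε) % 2 = 1
  · have := heightFlow_le ε c T h hb T le_rfl c hc (by simp)
    omega
  -- Here the bond `c` is idle in the last round. The bound one round earlier is `2 * h ≤ 1`, and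
  -- integrality gives `h ≤ 0`.
  · obtain ⟨t, rfl⟩ : ∃ t, T = t + 1 := ⟨T - 1, by omega⟩
    have := heightFlow_le ε c (t + 1) h hb t (by omega) c (by push_cast at hc; omega) (by simp)
    simp only [heightFlow]
    push_cast at hc this
    rw [if_neg (by omega)]
    omega

/-- At time `T` no value at most `c` lies beyond the bond `c`. A value that is too large at `x`
contradicts the dual height at `x - 1`; one that is too small contradicts the height at `x`. -/
theorem oddEvenSort_eq_id (ε : ℤ) (T : ℕ) (hT : 0 < T) (d : ℤ → ℤ) (h : ℤ → ℤ → ℤ)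
    (hd : ∀ c x, h c (x - 1) - h c x = if d x ≤ c then 1 else 0)
    (h0 : ∀ c x, 0 ≤ h c x) (h1 : ∀ c x, 0 ≤ h c x + x - c)
    (hb : ∀ c z, (z + ε) % 2 = 1 → |z - c| ≤ T → 2 * h c z ≤ T + c - z) (x : ℤ) :
    oddEvenSort ε d T x = x := by
  have hle : ∀ c, heightFlow ε (h c) T c ≤ 0 := fun c => heightFlow_final ε c T hT _ (hb c)
  have hstep := fun c => heightFlow_step ε c d (h c) (hd c) T
  apply le_antisymm
  · by_contra hlt
    push Not at hlt
    have h2 := hstep x x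
    rw [if_neg (by omega)] at h2
    have h3 := heightFlow_add_nonneg ε x (h x) (h1 x) T (x - 1)
    have := hle x
    omega
  · by_contra hlt
    push Not at hlt
    have h2 := hstep (x - 1) x
    rw [if_pos (by omega)] at h2
    have h3 := heightFlow_nonneg ε (h (x - 1)) (h0 (x - 1)) T x
    have := hle (x - 1)
    omega

/-! ### Heights of an affine permutation as sums over residue classes. -/

/-- The signed number of elements of the residue class of `x` modulo `n` which `d` carries from the
right of the bond `{z, z + 1}` to a value at most `c` (or, negatively, from the left of the bond to
a value larger than `c`). -/
def cutTerm (n : ℕ) (d : ℤ → ℤ) (c z x : ℤ) : ℤ := (c - d x) / n - (z - x) / n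

theorem sum_range_emod_eq {n : ℕ} (hn : 0 < n) (g : ℕ → ℤ)
    (hg : ∀ i < n, ∀ j < n, (n : ℤ) ∣ g i - g j → i = j) :
    ∑ j ∈ Finset.range n, g j % n = ∑ j ∈ Finset.range n, (j : ℤ) := by
  have hn' : (0 : ℤ) < n := by exact_mod_cast hn
  have hcast : ∀ j, (((g j % n).toNat : ℕ) : ℤ) = g j % n := fun j =>
    Int.toNat_of_nonneg (Int.emod_nonneg _ hn'.ne')
  have hinj : Set.InjOn (fun j => (g j % n).toNat) (Finset.range n) := by
    intro i hi j hj hij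
    have hi' := Finset.mem_range.1 (Finset.mem_coe.1 hi)
    have hj' := Finset.mem_range.1 (Finset.mem_coe.1 hj)
    refine hg i hi' j hj'
      (Int.dvd_of_emod_eq_zero (Int.emod_eq_emod_iff_emod_sub_eq_zero.1 ?_))
    rw [← hcast i, ← hcast j]
    exact_mod_cast hij
  have himg : (Finset.range n).image (fun j => (g j % n).toNat) = Finset.range n := by
    refine Finset.eq_of_subset_of_card_le ?_ ?_
    · intro k hk
      obtain ⟨j, -, rfl⟩ := Finset.mem_image.1 hk
      have := Int.emod_lt_of_pos (g j) hn'
      rw [Finset.mem_range]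
      have := hcast j
      omega
    · rw [Finset.card_image_of_injOn hinj]
  calc ∑ j ∈ Finset.range n, g j % n
      = ∑ j ∈ Finset.range n, (((g j % n).toNat : ℕ) : ℤ) := by simp only [hcast]
    _ = ∑ k ∈ (Finset.range n).image (fun j => (g j % n).toNat), (k : ℤ) :=
        (Finset.sum_image (f := fun k : ℕ => (k : ℤ)) hinj).symm
    _ = _ := by rw [himg]

theorem sum_range_periodic {n : ℕ} (g : ℤ → ℤ) (hg : ∀ x, g (x + n) = g x) (u : ℤ) :
    ∑ j ∈ Finset.range n, g (u + j) = ∑ j ∈ Finset.range n, g j := by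
  have step : ∀ v : ℤ, ∑ j ∈ Finset.range n, g (v + 1 + j) = ∑ j ∈ Finset.range n, g (v + j) := by
    intro v
    have h1 := Finset.sum_range_succ (fun j : ℕ => g (v + j)) n
    have h2 := Finset.sum_range_succ' (fun j : ℕ => g (v + j)) n
    have h3 : ∀ j : ℕ, v + ((j + 1 : ℕ) : ℤ) = v + 1 + j := fun j => by push_cast; ring
    simp only [h3, hg, Nat.cast_zero, add_zero] at h1 h2
    linarith
  induction u using Int.induction_on with
  | zero => simp
  | succ i ih => rw [step, ih]
  | pred i ih => rw [← ih, ← step, sub_add_cancel]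

namespace IsAffinePerm

variable {n : ℕ} {d : ℤ → ℤ}

theorem shift_mul (hd : IsAffinePerm n d) (x j : ℤ) : d (x + n * j) = d x + n * j := by
  induction j using Int.induction_on with
  | zero => simp
  | succ i ih => rw [show x + n * ((i : ℤ) + 1) = x + n * i + n by ring, hd.shift, ih]; ring
  | pred i ih =>
    have := hd.shift (x + n * (-(i : ℤ) - 1))
    rw [show x + n * (-(i : ℤ) - 1) + n = x + n * (-i) by ring, ih] at this
    linarith

theorem injective (hd : IsAffinePerm n d) : Function.Injective d := by
  intro x y hxy
  obtain ⟨j, hj⟩ := hd.inj x y (by simp [hxy])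
  have := hd.shift_mul y j
  rw [show y + n * j = x by linarith] at this
  linarith

theorem cutTerm_shift (hd : IsAffinePerm n d) (hn : 0 < n) (c z x : ℤ) :
    cutTerm n d c z (x + n) = cutTerm n d c z x := by
  have hn' : (n : ℤ) ≠ 0 := by exact_mod_cast hn.ne'
  unfold cutTerm
  rw [hd.shift, show c - (d x + n) = c - d x + n * (-1) by ring,
    show z - (x + n) = z - x + n * (-1) by ring, Int.add_mul_ediv_left _ _ hn',
    Int.add_mul_ediv_left _ _ hn']
  ring

/-- Replace each floor by its remainder: both families of remainders run once through all residues,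
so they cancel, and the displacements sum to zero. -/
theorem sum_cutTerm (hd : IsAffinePerm n d) (hn : 0 < n) (c z : ℤ) :
    ∑ j ∈ Finset.range n, cutTerm n d c z j = c - z := by
  have hn' : (n : ℤ) ≠ 0 := by exact_mod_cast hn.ne'
  have small : ∀ i < n, ∀ j < n, (n : ℤ) ∣ (i : ℤ) - j → i = j := by
    intro i hi j hj h
    have := Int.eq_zero_of_abs_lt_dvd h (by rw [abs_lt]; omega)
    omega
  have h1 := sum_range_emod_eq hn (fun j => c - d j) (fun i hi j hj h => small i hi j hj
    (hd.inj _ _ ((dvd_sub_comm).1 (by simpa using h))))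
  have h2 := sum_range_emod_eq hn (fun j => z - j) (fun i hi j hj h => small i hi j hj
    ((dvd_sub_comm).1 (by simpa using h)))
  have h3 : ∀ j : ℕ, (n : ℤ) * cutTerm n d c z j
      = (c - z) + ((j : ℤ) - d j) + ((z - j) % n - (c - d j) % n) := by
    intro j
    have e1 := Int.mul_ediv_add_emod (c - d j) n
    have e2 := Int.mul_ediv_add_emod (z - j) n
    unfold cutTerm
    linear_combination e1 - e2
  refine mul_left_cancel₀ hn' ?_
  rw [Finset.mul_sum, Finset.sum_congr rfl (fun j _ => h3 j), Finset.sum_add_distrib,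
    Finset.sum_add_distrib, Finset.sum_sub_distrib, Finset.sum_sub_distrib, Finset.sum_sub_distrib, h1, h2, hd.sum]
  simp
  ring

/-- The sum of the positive parts is the height function. Moving the bond past `x` alters only the
term of the class of `x`. -/
theorem sum_max_cutTerm_sub (hd : IsAffinePerm n d) (hn : 0 < n) (c x : ℤ) :
    ∑ j ∈ Finset.range n, max (cutTerm n d c (x - 1) j) 0
      - ∑ j ∈ Finset.range n, max (cutTerm n d c x j) 0 = if d x ≤ c then 1 else 0 := by
  have hn' : (0 : ℤ) < n := by exact_mod_cast hn
  rw [← sum_range_periodic (fun y => max (cutTerm n d c (x - 1) y) 0)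
      (fun y => by rw [hd.cutTerm_shift hn]) x,
    ← sum_range_periodic (fun y => max (cutTerm n d c x y) 0)
      (fun y => by rw [hd.cutTerm_shift hn]) x, ← Finset.sum_sub_distrib,
    Finset.sum_eq_single_of_mem 0 (by simpa using hn)]
  · have e1 : (x - 1 - x) / (n : ℤ) = -1 := by
      rw [Int.ediv_eq_iff_of_pos hn']; constructor <;> linarith
    simp only [cutTerm, Nat.cast_zero, add_zero, sub_self, Int.zero_ediv, e1]
    have e2 : d x ≤ c ↔ 0 ≤ (c - d x) / n := by
      rw [Int.le_ediv_iff_mul_le hn']; constructor <;> intro h <;> linarith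
    split_ifs with h
    · have := e2.1 h
      omega
    · have := mt e2.2 h
      omega
  · intro j hj hj0
    have hj := Finset.mem_range.1 hj
    have e1 : (x - 1 - (x + j)) / (n : ℤ) = -1 := by
      rw [Int.ediv_eq_iff_of_pos hn']; constructor <;> omega
    have e2 : (x - (x + j)) / (n : ℤ) = -1 := by
      rw [Int.ediv_eq_iff_of_pos hn']; constructor <;> omega
    simp only [cutTerm, e1, e2, sub_self]

theorem two_mul_sum_max_cutTerm (hd : IsAffinePerm n d) (hn : 0 < n) (c z : ℤ) :
    2 * ∑ j ∈ Finset.range n, max (cutTerm n d c z j) 0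
      = ∑ j ∈ Finset.range n, |cutTerm n d c z j| + (c - z) := by
  rw [← hd.sum_cutTerm hn c z, Finset.mul_sum, ← Finset.sum_add_distrib]
  refine Finset.sum_congr rfl fun j _ => ?_
  rcases abs_cases (cutTerm n d c z j) with h | h <;> omega

theorem oddEvenSort_eq_id (hd : IsAffinePerm n d) (hn : 0 < n) (ε : ℤ) (T : ℕ) (hT : 0 < T)
    (h : ∀ c z, (z + ε) % 2 = 1 → |z - c| ≤ T →
      ∑ j ∈ Finset.range n, |cutTerm n d c z j| ≤ T) (x : ℤ) :
    oddEvenSort ε d T x = x := by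
  refine _root_.oddEvenSort_eq_id ε T hT d
    (fun c z => ∑ j ∈ Finset.range n, max (cutTerm n d c z j) 0)
    (hd.sum_max_cutTerm_sub hn) (fun c z => Finset.sum_nonneg fun j _ => le_max_right _ _) ?_ ?_ x
  · intro c z
    have h1 := hd.two_mul_sum_max_cutTerm hn c z
    have h2 : |c - z| ≤ ∑ j ∈ Finset.range n, |cutTerm n d c z j| := by
      rw [← hd.sum_cutTerm hn c z]
      exact Finset.abs_sum_le_sum_abs _ _
    rw [abs_le] at h2
    omega
  · intro c z hz hzc
    have h1 := hd.two_mul_sum_max_cutTerm hn c z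
    have h2 := h c z hz hzc
    omega

end IsAffinePerm

/-! ### Cuts whose sum exceeds `n - 2`. -/

theorem Int.ediv_eq_neg_one_of_neg {y m : ℤ} (h1 : -m ≤ y) (h2 : y < 0) : y / m = -1 := by
  rw [Int.ediv_eq_iff_of_pos (by omega)]
  constructor <;> omega

theorem sum_abs_add_two_le {n : ℕ} (f : ℕ → ℤ) (hf : ∀ j < n, |f j| ≤ 1) {i k : ℕ} (hi : i < n)
    (hk : k < n) (hik : i ≠ k) (h1 : f i = 0) (h2 : f k = 0) :
    ∑ j ∈ Finset.range n, |f j| + 2 ≤ n := by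
  have h : ∑ j ∈ Finset.range n, (|f j| + ((if j = i then 1 else 0) + if j = k then 1 else 0))
      ≤ ∑ j ∈ Finset.range n, (1 : ℤ) := by
    refine Finset.sum_le_sum fun j hj => ?_
    have := hf j (Finset.mem_range.1 hj)
    split_ifs with ha hb hb
    · exact absurd (ha.symm.trans hb) hik
    · subst ha; simp [h1]
    · subst hb; simp [h2]
    · simpa using this
  simpa [Finset.sum_add_distrib, hi, hk] using h

/-- A bond `{z, z + 1}` and a threshold `c` for which the `n - 1` positions of a window starting at
`u` carry only large values up to `z` and only small values after `z`. -/
structure SaturatedCut (n : ℕ) (d : ℤ → ℤ) (z c u : ℤ) : Prop where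
  left_le : u ≤ z
  lt_right : z < u + n - 2
  threshold : c = 2 * u + n - 3 - z
  large : ∀ x, u ≤ x → x ≤ z → c < d x
  small : ∀ x, z < x → x ≤ u + n - 2 → d x ≤ c

namespace IsAffinePerm

variable {n : ℕ} {d : ℤ → ℤ}

theorem exists_large_left (hd : IsAffinePerm n d) (hn : 0 < n) {c z x : ℤ}
    (h : cutTerm n d c z x < 0) : ∃ y ≤ z, c < d y := by
  have hn' : (0 : ℤ) < n := by exact_mod_cast hn
  unfold cutTerm at h
  refine ⟨x + n * ((z - x) / n), ?_, ?_⟩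
  · have := Int.mul_ediv_self_le (x := z - x) hn'.ne'
    linarith
  · rw [hd.shift_mul]
    have := (Int.ediv_lt_iff_lt_mul hn').1 (by linarith : (c - d x) / n < (z - x) / n)
    linarith

theorem exists_small_right (hd : IsAffinePerm n d) (hn : 0 < n) {c z x : ℤ}
    (h : 0 < cutTerm n d c z x) : ∃ y > z, d y ≤ c := by
  have hn' : (0 : ℤ) < n := by exact_mod_cast hn
  unfold cutTerm at h
  refine ⟨x + n * ((c - d x) / n), ?_, ?_⟩
  · have := (Int.ediv_lt_iff_lt_mul hn').1 (by linarith : (z - x) / n < (c - d x) / n)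
    linarith
  · rw [hd.shift_mul]
    have := Int.mul_ediv_self_le (x := c - d x) hn'.ne'
    linarith

theorem sum_abs_of_nonneg (hd : IsAffinePerm n d) (hn : 0 < n) {c z : ℤ}
    (h : ∀ x, 0 ≤ cutTerm n d c z x) :
    ∑ j ∈ Finset.range n, |cutTerm n d c z j| = c - z := by
  rw [← hd.sum_cutTerm hn]
  exact Finset.sum_congr rfl fun j _ => abs_of_nonneg (h j)

theorem sum_abs_of_nonpos (hd : IsAffinePerm n d) (hn : 0 < n) {c z : ℤ}
    (h : ∀ x, cutTerm n d c z x ≤ 0) :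
    ∑ j ∈ Finset.range n, |cutTerm n d c z j| = z - c := by
  rw [← neg_sub c z, ← hd.sum_cutTerm hn, ← Finset.sum_neg_distrib]
  exact Finset.sum_congr rfl fun j _ => abs_of_nonpos (h j)

/-- Between the leftmost large value left of the bond and the rightmost small value right of it
there are at most `n - 1` positions. Hence all terms lie in `{-1, 0, 1}` and one is zero. A sum of
at least `n - 1` leaves no second zero. -/
theorem exists_saturatedCut (hd : IsAffinePerm n d) (hn : 3 ≤ n)
    (hspread : ∀ x y, (d x - x) - (d y - y) ≤ n) (hadj : ∀ x, d (x + 1) - d x ≤ n) {c z : ℤ}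
    (hzc : |z - c| ≤ n - 2) (hf : (n : ℤ) - 1 ≤ ∑ j ∈ Finset.range n, |cutTerm n d c z j|) :
    ∃ u, SaturatedCut n d z c u := by
  have hn0 : 0 < n := by omega
  have hn' : (0 : ℤ) < n := by exact_mod_cast hn0
  rw [abs_le] at hzc
  obtain ⟨x₀, hx₀, hx₀'⟩ : ∃ x ≤ z, c < d x := by
    by_contra! hno
    have := hd.sum_abs_of_nonneg hn0 (c := c) (z := z) fun x => by
      by_contra! hx
      obtain ⟨y, hy, hy'⟩ := hd.exists_large_left hn0 hx
      exact absurd (hno y hy) (by omega)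
    omega
  obtain ⟨y₀, hy₀, hy₀'⟩ : ∃ y > z, d y ≤ c := by
    by_contra! hno
    have := hd.sum_abs_of_nonpos hn0 (c := c) (z := z) fun x => by
      by_contra! hx
      obtain ⟨y, hy, hy'⟩ := hd.exists_small_right hn0 hx
      exact absurd (hno y hy) (by omega)
    omega
  obtain ⟨u, ⟨huz, hcu⟩, humin⟩ := Int.exists_least_of_bdd (P := fun x => x ≤ z ∧ c < d x)
    ⟨y₀ - n, fun x hx => by have := hspread x y₀; omega⟩ ⟨x₀, hx₀, hx₀'⟩
  obtain ⟨v, ⟨hzv, hvc⟩, hvmax⟩ := Int.exists_greatest_of_bdd (P := fun x => z < x ∧ d x ≤ c)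
    ⟨x₀ + n, fun x hx => by have := hspread x₀ x; omega⟩ ⟨y₀, hy₀, hy₀'⟩
  -- `hspread` alone gives `v ≤ u + n - 1`; equality would make `d` jump by more than `n` from `u -
  -- 1` to `u`.
  have huv : v ≤ u + n - 2 := by
    have h1 := hspread u v
    have h2 := hadj (u - 1)
    have h3 := hd.shift (u - 1)
    rw [sub_add_cancel] at h2
    by_contra hlt
    have h4 : v = u - 1 + n := by omega
    rw [h4] at hvc
    omega
  have hleft : ∀ x < u, x ≤ z → d x ≤ c := fun x hx hxz => by
    by_contra hcx
    have := humin x ⟨hxz, by omega⟩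
    omega
  have hright : ∀ x, v < x → z < x → c < d x := fun x hx hxz => by
    by_contra hcx
    have := hvmax x ⟨hxz, by omega⟩
    omega
  have hlow : ∀ x, v < x + n → z < x + n → c - d x < n := fun x h1 h2 => by
    have := hright _ h1 h2
    rw [hd.shift] at this
    omega
  have hhigh : ∀ x, x - n < u → x - n ≤ z → -n ≤ c - d x := fun x h1 h2 => by
    have := hleft _ h1 h2
    have := hd.shift (x - n)
    rw [sub_add_cancel] at this
    omega
  have key : ∀ x, v - n < x → x ≤ v → cutTerm n d c z x =
      if x < u then 0 else if x ≤ z then (if c < d x then -1 else 0)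
      else if d x ≤ c then 1 else 0 := by
    intro x hx1 hx2
    have h1 := hlow x (by omega) (by omega)
    unfold cutTerm
    split_ifs with hu hz hc hc
    · have := hleft x hu (by omega)
      rw [Int.ediv_eq_zero_of_lt (by omega) (by omega),
        Int.ediv_eq_zero_of_lt (by omega) (by omega), sub_self]
    · have := hhigh x (by omega) (by omega)
      rw [Int.ediv_eq_neg_one_of_neg (by omega) (by omega),
        Int.ediv_eq_zero_of_lt (by omega) (by omega)]
      rfl
    · rw [Int.ediv_eq_zero_of_lt (by omega) (by omega),
        Int.ediv_eq_zero_of_lt (by omega) (by omega), sub_self]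
    · rw [Int.ediv_eq_zero_of_lt (by omega) (by omega),
        Int.ediv_eq_neg_one_of_neg (by omega) (by omega)]
      rfl
    · have := hhigh x (by omega) (by omega)
      rw [Int.ediv_eq_neg_one_of_neg (by omega) (by omega),
        Int.ediv_eq_neg_one_of_neg (by omega) (by omega), sub_self]
  have hper : ∀ g : ℤ → ℤ, ∑ j ∈ Finset.range n, g (cutTerm n d c z j) =
      ∑ j ∈ Finset.range n, g (cutTerm n d c z (v - n + 1 + j)) := fun g =>
    (sum_range_periodic (fun x => g (cutTerm n d c z x))
      (fun x => by rw [hd.cutTerm_shift hn0]) _).symm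
  -- The position `v - n + 1` lies left of `u`, so it already contributes a zero term.
  have hne : ∀ x, v - n + 1 < x → x ≤ v → cutTerm n d c z x ≠ 0 := by
    intro x hx1 hx2 h0
    have h2 := sum_abs_add_two_le (n := n) (fun j => cutTerm n d c z (v - n + 1 + j))
      (fun j hj => by rw [key _ (by omega) (by omega)]; split_ifs <;> simp)
      (i := 0) (k := (x - (v - n + 1)).toNat) hn0 (by omega) (by omega)
      (by simp only [Nat.cast_zero, add_zero]
          rw [key _ (by omega) (by omega), if_pos (by omega)])
      (by rw [show v - n + 1 + (((x - (v - n + 1)).toNat : ℕ) : ℤ) = x by omega]; exact h0)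
    have h1 := hper (fun t => |t|)
    omega
  have huv' : v = u + n - 2 := by
    by_contra hlt
    exact hne (u - 1) (by omega) (by omega)
      (by rw [key _ (by omega) (by omega), if_pos (by omega)])
  have hlarge : ∀ x, u ≤ x → x ≤ z → c < d x := by
    intro x h1 h2
    have := hne x (by omega) (by omega)
    rw [key x (by omega) (by omega), if_neg (by omega), if_pos h2] at this
    by_contra h3
    exact this (if_neg h3)
  have hsmall : ∀ x, z < x → x ≤ u + n - 2 → d x ≤ c := by
    intro x h1 h2
    have := hne x (by omega) (by omega)
    rw [key x (by omega) (by omega), if_neg (by omega), if_neg (by omega)] at this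
    by_contra h3
    exact this (if_neg h3)
  refine ⟨u, huz, by omega, ?_, hlarge, hsmall⟩
  -- Counting the terms `-1` and `1` and comparing with the total `c - z` determines `c`.
  have hsum := hd.sum_cutTerm hn0 c z
  rw [hper (fun t => t)] at hsum
  obtain ⟨a, ha⟩ : ∃ a : ℕ, z = u + a := ⟨(z - u).toNat, by omega⟩
  obtain ⟨b, hb⟩ : ∃ b : ℕ, v = z + b := ⟨(v - z).toNat, by omega⟩
  have hnab : n = 1 + (a + 1) + b := by omega
  have s1 : ∀ j ∈ Finset.range (a + 1), cutTerm n d c z (v - n + 1 + ((1 + j : ℕ) : ℤ)) = -1 := by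
    intro j hj
    have := Finset.mem_range.1 hj
    rw [key _ (by omega) (by omega), if_neg (by omega), if_pos (by omega),
      if_pos (hlarge _ (by omega) (by omega))]
  have s2 : ∀ j ∈ Finset.range b,
      cutTerm n d c z (v - n + 1 + ((1 + (a + 1) + j : ℕ) : ℤ)) = 1 := by
    intro j hj
    have := Finset.mem_range.1 hj
    rw [key _ (by omega) (by omega), if_neg (by omega), if_neg (by omega),
      if_pos (hsmall _ (by omega) (by omega))]
  have s0 : cutTerm n d c z (v - n + 1 + ((0 : ℕ) : ℤ)) = 0 := by
    rw [key _ (by simp) (by omega), if_pos (by omega)]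
  have hrange : ∑ j ∈ Finset.range n, cutTerm n d c z (v - n + 1 + j) =
      ∑ j ∈ Finset.range (1 + (a + 1) + b), cutTerm n d c z (v - n + 1 + j) := by
    rw [← hnab]
  rw [hrange, Finset.sum_range_add, Finset.sum_range_add, Finset.sum_range_one, s0,
    Finset.sum_congr rfl s1, Finset.sum_congr rfl s2] at hsum
  simp at hsum
  omega

end IsAffinePerm

/-! ### Runs of constant displacement modulo `n`, used to break ties. -/

/-- The distance from `x` to the first position at or after `x` satisfying `P`. -/
noncomputable def forwardRun (P : ℤ → Prop) (x : ℤ) : ℕ := sInf {j : ℕ | P (x + j)}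

/-- The distance from `x - 1` to the last position before `x` satisfying `P`. -/
noncomputable def backRun (P : ℤ → Prop) (x : ℤ) : ℕ := sInf {j : ℕ | P (x - 1 - j)}

theorem Nat.sInf_eq_succ_of_not {S S' : Set ℕ} (hS : S.Nonempty) (h0 : 0 ∉ S)
    (h : ∀ j, j + 1 ∈ S ↔ j ∈ S') : sInf S = sInf S' + 1 := by
  have hmem := Nat.sInf_mem hS
  obtain ⟨j, hj⟩ : ∃ j, sInf S = j + 1 := Nat.exists_eq_succ_of_ne_zero fun h' => h0 (h' ▸ hmem)
  have hj' : j ∈ S' := (h j).1 (hj ▸ hmem)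
  have h1 := Nat.sInf_le hj'
  have h2 := Nat.sInf_le ((h _).2 (Nat.sInf_mem ⟨j, hj'⟩))
  omega

section Runs

variable {P : ℤ → Prop}

theorem forwardRun_eq_succ {x : ℤ} (hP : ∃ j : ℕ, P (x + j)) (hx : ¬ P x) :
    forwardRun P x = forwardRun P (x + 1) + 1 := by
  refine Nat.sInf_eq_succ_of_not hP (by simpa using hx) fun j => ?_
  simp [add_assoc, add_comm (j : ℤ)]

theorem backRun_eq_succ {x : ℤ} (hP : ∃ j : ℕ, P (x - j)) (hx : ¬ P x) :
    backRun P (x + 1) = backRun P x + 1 := by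
  refine Nat.sInf_eq_succ_of_not (by simpa [Set.Nonempty] using hP) (by simpa using hx) fun j => ?_
  simp only [Set.mem_ofPred_eq]
  rw [show x + 1 - 1 - ((j + 1 : ℕ) : ℤ) = x - 1 - j by push_cast; ring]

theorem forwardRun_eq_zero {x : ℤ} (hx : P x) : forwardRun P x = 0 :=
  Nat.sInf_eq_zero.2 (Or.inl (by simpa using hx))

theorem backRun_eq_zero {x : ℤ} (hx : P x) : backRun P (x + 1) = 0 :=
  Nat.sInf_eq_zero.2 (Or.inl (by simpa using hx))

theorem le_forwardRun {x : ℤ} (hP : ∃ j : ℕ, P (x + j)) {m : ℕ} (h : ∀ j < m, ¬ P (x + j)) :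
    m ≤ forwardRun P x := by
  by_contra! hlt
  exact h _ hlt (Nat.sInf_mem hP)

theorem le_backRun {x : ℤ} (hP : ∃ j : ℕ, P (x - 1 - j)) {m : ℕ} (h : ∀ j < m, ¬ P (x - 1 - j)) :
    m ≤ backRun P x := by
  by_contra! hlt
  exact h _ hlt (Nat.sInf_mem hP)

theorem forwardRun_add_period {n : ℤ} (hP : ∀ x, P (x + n) ↔ P x) (x : ℤ) :
    forwardRun P (x + n) = forwardRun P x := by
  unfold forwardRun
  congr 1
  ext j
  simp only [Set.mem_ofPred_eq]
  rw [add_right_comm, hP]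

theorem backRun_add_period {n : ℤ} (hP : ∀ x, P (x + n) ↔ P x) (x : ℤ) :
    backRun P (x + n) = backRun P x := by
  unfold backRun
  congr 1
  ext j
  simp only [Set.mem_ofPred_eq]
  rw [show x + n - 1 - j = x - 1 - j + n by ring, hP]

theorem periodic_mul {n : ℤ} (hP : ∀ x, P (x + n) ↔ P x) (x : ℤ) (k : ℕ) :
    (P (x + n * k) ↔ P x) ∧ (P (x - n * k) ↔ P x) := by
  induction k with
  | zero => simp
  | succ k ih =>
    constructor
    · rw [← ih.1, ← hP (x + n * k)]
      push_cast
      ring_nf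
    · rw [← ih.2, ← hP (x - n * (k + 1 : ℕ))]
      push_cast
      ring_nf

/-- One break recurs with period `n`, so the sets defining the runs are nonempty and the default
`sInf ∅ = 0` never intervenes. -/
theorem exists_nat_add {n : ℤ} (hn : 0 < n) (hP : ∀ x, P (x + n) ↔ P x) (hex : ∃ x, P x) (x : ℤ) :
    ∃ j : ℕ, P (x + j) := by
  obtain ⟨y, hy⟩ := hex
  refine ⟨(y + n * (x - y).toNat - x).toNat, ?_⟩
  have : x ≤ y + n * (x - y).toNat := by
    have h1 : (x - y).toNat ≤ n * ((x - y).toNat : ℤ) := le_mul_of_one_le_left (by omega) hn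
    omega
  rw [show x + (((y + n * (x - y).toNat - x).toNat : ℕ) : ℤ) = y + n * (x - y).toNat by omega]
  exact (periodic_mul hP y _).1.2 hy

theorem exists_nat_sub {n : ℤ} (hn : 0 < n) (hP : ∀ x, P (x + n) ↔ P x) (hex : ∃ x, P x) (x : ℤ) :
    ∃ j : ℕ, P (x - j) := by
  obtain ⟨y, hy⟩ := hex
  refine ⟨(x - (y - n * (y - x).toNat)).toNat, ?_⟩
  have : y - n * (y - x).toNat ≤ x := by
    have h1 : (y - x).toNat ≤ n * ((y - x).toNat : ℤ) := le_mul_of_one_le_left (by omega) hn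
    omega
  rw [show x - (((x - (y - n * (y - x).toNat)).toNat : ℕ) : ℤ) = y - n * (y - x).toNat by omega]
  exact (periodic_mul hP y _).2.2 hy

end Runs

/-- The position of `x` in its maximal run, measured from the centre of the run; the runs are
separated by the bonds `{y, y + 1}` with `P y`. -/
noncomputable def runHeight (P : ℤ → Prop) (x : ℤ) : ℤ := backRun P x - forwardRun P x

/-! ### Rigidity of saturated cuts. -/

namespace SaturatedCut

variable {n : ℕ} {d : ℤ → ℤ} {z c u z' c' u' : ℤ}

theorem shift (hd : IsAffinePerm n d) (h : SaturatedCut n d z c u) (j : ℤ) :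
    SaturatedCut n d (z + n * j) (c + n * j) (u + n * j) where
  left_le := by linarith [h.left_le]
  lt_right := by linarith [h.lt_right]
  threshold := by linarith [h.threshold]
  large x h1 h2 := by
    have h3 := h.large (x - n * j) (by linarith) (by linarith)
    have h4 := hd.shift_mul (x - n * j) j
    rw [sub_add_cancel] at h4
    linarith
  small x h1 h2 := by
    have h3 := h.small (x - n * j) (by linarith) (by linarith)
    have h4 := hd.shift_mul (x - n * j) j
    rw [sub_add_cancel] at h4
    linarith

/-- Compare the displacement of the large value at the left end of one window with that of the small
value at the right end of the other. -/
theorem sub_le_one (hspread : ∀ x y, (d x - x) - (d y - y) ≤ n) (h : SaturatedCut n d z c u)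
    (h' : SaturatedCut n d z' c' u') : (z' - u') - (z - u) ≤ 1 := by
  have h1 := h.large u le_rfl h.left_le
  have h2 := h'.small (u' + n - 2) h'.lt_right le_rfl
  have h3 := hspread u (u' + n - 2)
  have := h.threshold
  have := h'.threshold
  omega

/-- For distinct windows within a period, some position, up to a shift by `n`, would have to be
large for one cut and small for the other, with incompatible thresholds. Opposite parity is what
settles the windows offset by `1` or `n - 1`. -/
theorem left_unique (hd : IsAffinePerm n d) (hspread : ∀ x y, (d x - x) - (d y - y) ≤ n)
    (h : SaturatedCut n d z c u) (h' : SaturatedCut n d z' c' u') (h1 : u ≤ u') (h2 : u' < u + n)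
    (hpar : (z' - z) % 2 = 1) (hn : (n : ℤ) % 2 = 0) : u' = u := by
  have b1 := h.sub_le_one hspread h'
  have b2 := h'.sub_le_one hspread h
  have e1 := h.threshold
  have e2 := h'.threshold
  have i1 := h.left_le
  have i2 := h'.left_le
  have i3 := h.lt_right
  have i4 := h'.lt_right
  by_contra hne
  rcases (by omega : u' = u + 1 ∨ u' = u + n - 1 ∨ (u + 2 ≤ u' ∧ u' ≤ u + n - 2)) with h3 | h3 | h3
  · have := h.small (z + 1) (by omega) (by omega)
    have := h'.large (z + 1) (by omega) (by omega)
    omega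
  · have := h.large z (by omega) (by omega)
    have := h'.small (z + n) (by omega) (by omega)
    have := hd.shift z
    omega
  · by_cases h4 : u' ≤ z
    · have := h.large (u' - 2) (by omega) (by omega)
      have := h'.small (u' - 2 + n) (by omega) (by omega)
      have := hd.shift (u' - 2)
      omega
    · have := h.small u' (by omega) (by omega)
      have := h'.large u' (by omega) (by omega)
      omega

/-- Here `c' = c - 1`. The value at `u + n - 2` and the spread bound `d x` above by the claimed
value, while `d x > c` bounds it below by the claimed value at `u`. Injectivity then fills the
values in from the left. -/
theorem eq_add_of_succ (hd : IsAffinePerm n d) (hspread : ∀ x y, (d x - x) - (d y - y) ≤ n)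
    (h : SaturatedCut n d z c u) (h' : SaturatedCut n d (z + 1) c' u) (x : ℤ) (h1 : u ≤ x)
    (h2 : x ≤ z) : d x = x + (u + n - 2 - z) := by
  induction hk : (x - u).toNat using Nat.strong_induction_on generalizing x with
  | _ k ih =>
    have e1 := h.threshold
    have e2 := h'.threshold
    have i3 := h'.lt_right
    have a1 := h.large x h1 h2
    have a2 := h'.small (u + n - 2) i3 le_rfl
    have a3 := hspread x (u + n - 2)
    by_contra hne
    obtain ⟨y, hy⟩ : ∃ y, y = d x - (u + n - 2 - z) := ⟨_, rfl⟩
    have := ih (y - u).toNat (by omega) y (by omega) (by omega) rfl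
    have := hd.injective (a₁ := x) (a₂ := y) (by omega)
    omega

/-- The mirror image, filled in from the right end of the window. -/
theorem eq_sub_of_succ (hd : IsAffinePerm n d) (hspread : ∀ x y, (d x - x) - (d y - y) ≤ n)
    (h : SaturatedCut n d z c u) (h' : SaturatedCut n d (z + 1) c' u) (x : ℤ) (h1 : z + 2 ≤ x)
    (h2 : x ≤ u + n - 2) : d x = x + (u - 2 - z) := by
  induction hk : (u + n - 2 - x).toNat using Nat.strong_induction_on generalizing x with
  | _ k ih =>
    have e1 := h.threshold
    have e2 := h'.threshold
    have i3 := h.left_le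
    have a1 := h'.small x (by omega) h2
    have a2 := h.large u le_rfl i3
    have a3 := hspread u x
    by_contra hne
    obtain ⟨y, hy⟩ : ∃ y, y = d x - (u - 2 - z) := ⟨_, rfl⟩
    have := ih (u + n - 2 - y).toNat (by omega) y (by omega) (by omega) rfl
    have := hd.injective (a₁ := x) (a₂ := y) (by omega)
    omega

end SaturatedCut

/-- The bond `{x, x + 1}` joins two positions with displacements distinct modulo `n`. -/
def IsBreak (n : ℕ) (d : ℤ → ℤ) (x : ℤ) : Prop := ¬ (n : ℤ) ∣ d (x + 1) - d x - 1

namespace IsAffinePerm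

variable {n : ℕ} {d : ℤ → ℤ}

theorem isBreak_shift (hd : IsAffinePerm n d) (x : ℤ) : IsBreak n d (x + n) ↔ IsBreak n d x := by
  unfold IsBreak
  rw [add_right_comm, hd.shift, hd.shift, add_sub_add_right_eq_sub]

/-- The displacements at `z` and `z + 2` differ by exactly `n`. But `z` ends a run reaching back at
least to `u`, and `z + 2` begins one reaching at least to `u + n - 2`, so the tie-break would force
`n ≤ 4`. -/
theorem not_saturatedCut_succ (hd : IsAffinePerm n d) (hn : 6 ≤ n)
    (hspread : ∀ x y, (d x - x) - (d y - y) ≤ n) (hbreak : ∃ x, IsBreak n d x)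
    (htie : ∀ x y, (d x - x) - (d y - y) = n →
      runHeight (IsBreak n d) x ≤ runHeight (IsBreak n d) y)
    {z c u c' : ℤ} (h : SaturatedCut n d z c u) (h' : SaturatedCut n d (z + 1) c' u) : False := by
  have hn' : (0 : ℤ) < n := by omega
  have e1 := h.threshold
  have e2 := h'.threshold
  have i1 := h.left_le
  have i2 := h'.lt_right
  have a1 := h.small (z + 1) (by omega) (by omega)
  have a2 := h'.large (z + 1) (by omega) (by omega)
  have b1 := SaturatedCut.eq_add_of_succ hd hspread h h'
  have b2 := SaturatedCut.eq_sub_of_succ hd hspread h h'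
  have c1 := b1 z i1 le_rfl
  have c2 := b2 (z + 2) le_rfl (by omega)
  have hzu : ¬ (n : ℤ) ∣ z + 2 - u := fun hdvd => by
    have := Int.le_of_dvd (by omega) hdvd
    omega
  have p1 : IsBreak n d z := fun hdvd => hzu (by
    rwa [show d (z + 1) - d z - 1 = -(z + 2 - u) by omega, dvd_neg] at hdvd)
  have p2 : IsBreak n d (z + 1) := fun hdvd => hzu (by
    rwa [show z + 1 + 1 = z + 2 by ring, show d (z + 2) - d (z + 1) - 1 = z + 2 - u - n by omega,
      dvd_sub_self_right] at hdvd)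
  have f1 := forwardRun_eq_zero p1
  have f2 := backRun_eq_zero p2
  have f3 : (z - u).toNat ≤ backRun (IsBreak n d) z := by
    obtain ⟨j, hj⟩ := exists_nat_sub hn' hd.isBreak_shift hbreak (z - 1)
    refine le_backRun ⟨j, hj⟩ fun j hj hP => hP ?_
    rw [b1 _ (by omega) (by omega), b1 _ (by omega) (by omega)]
    simp
  have f4 : (u + n - 4 - z).toNat ≤ forwardRun (IsBreak n d) (z + 1 + 1) := by
    refine le_forwardRun (exists_nat_add hn' hd.isBreak_shift hbreak _) fun j hj hP => hP ?_
    rw [b2 _ (by omega) (by omega), b2 _ (by omega) (by omega)]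
    simp
  have h3 := htie z (z + 2) (by omega)
  rw [show z + 2 = z + 1 + 1 by ring] at h3
  unfold runHeight at h3
  omega

theorem exists_parity (hd : IsAffinePerm n d) (hn : 6 ≤ n) (heven : Even n)
    (hspread : ∀ x y, (d x - x) - (d y - y) ≤ n) (hbreak : ∃ x, IsBreak n d x)
    (htie : ∀ x y, (d x - x) - (d y - y) = n →
      runHeight (IsBreak n d) x ≤ runHeight (IsBreak n d) y) :
    ∃ ε : ℤ, ∀ c z, (z + ε) % 2 = 1 → |z - c| ≤ ((n - 2 : ℕ) : ℤ) →
      ∑ j ∈ Finset.range n, |cutTerm n d c z j| ≤ ((n - 2 : ℕ) : ℤ) := by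
  have hn' : (0 : ℤ) < n := by omega
  have heven' : (n : ℤ) % 2 = 0 := by obtain ⟨m, hm⟩ := heven; omega
  -- A larger jump would be a tie between neighbours in one run, where `runHeight` increases by two
  -- from `x` to `x + 1`, against the tie-break.
  have hadj : ∀ x, d (x + 1) - d x ≤ n := by
    intro x
    have h1 := hspread (x + 1) x
    by_contra hlt
    have hx : ¬ IsBreak n d x := not_not.2 ⟨1, by omega⟩
    have h2 := htie (x + 1) x (by omega)
    unfold runHeight at h2
    rw [backRun_eq_succ (exists_nat_sub hn' hd.isBreak_shift hbreak x) hx,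
      forwardRun_eq_succ (exists_nat_add hn' hd.isBreak_shift hbreak x) hx] at h2
    omega
  have hcut : ∀ c z, |z - c| ≤ ((n - 2 : ℕ) : ℤ) →
      ¬ ∑ j ∈ Finset.range n, |cutTerm n d c z j| ≤ ((n - 2 : ℕ) : ℤ) →
      ∃ u, SaturatedCut n d z c u := fun c z h1 h2 =>
    hd.exists_saturatedCut (by omega) hspread hadj (by omega) (by omega)
  by_contra! hno
  obtain ⟨c₀, z₀, hz₀, hc₀, hs₀⟩ := hno 0
  obtain ⟨c₁, z₁, hz₁, hc₁, hs₁⟩ := hno 1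
  obtain ⟨u₀, h₀⟩ := hcut c₀ z₀ hc₀ (by omega)
  obtain ⟨u₁, h₁⟩ := hcut c₁ z₁ hc₁ (by omega)
  obtain ⟨m, hm⟩ := heven
  -- Translate the second cut so that its window starts within one period after `u₀`; parities
  -- survive because `n` is even.
  have h₂ := h₁.shift hd (-((u₁ - u₀) / n))
  have e1 := Int.mul_ediv_add_emod (u₁ - u₀) n
  have e2 := Int.emod_nonneg (u₁ - u₀) hn'.ne'
  have e3 := Int.emod_lt_of_pos (u₁ - u₀) hn'
  have e4 : (n : ℤ) * -((u₁ - u₀) / n) = 2 * (m * -((u₁ - u₀) / n)) := by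
    rw [hm]; push_cast; ring
  have e5 : (n : ℤ) * -((u₁ - u₀) / n) = -(n * ((u₁ - u₀) / n)) := by ring
  have hu := h₀.left_unique hd hspread h₂ (by omega) (by omega) (by omega) heven'
  rw [hu] at h₂
  have b1 := h₀.sub_le_one hspread h₂
  have b2 := h₂.sub_le_one hspread h₀
  rcases (by omega : z₁ + n * -((u₁ - u₀) / n) = z₀ + 1 ∨
    z₀ = z₁ + n * -((u₁ - u₀) / n) + 1) with h3 | h3
  · rw [h3] at h₂
    exact hd.not_saturatedCut_succ hn hspread hbreak htie h₀ h₂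
  · rw [h3] at h₀
    exact hd.not_saturatedCut_succ hn hspread hbreak htie h₂ h₀

end IsAffinePerm

/-! ### Rotations by `k` with `2 ≤ k ≤ n - 2`. -/

/-- The lift of the rotation by `k` of the `n`-cycle in which the positions `1` and
`n - k + 1, …, n - 1` are moved backwards and all other positions forwards. -/
def rotationLift (n k : ℕ) (x : ℤ) : ℤ :=
  x + k - if x % n = 1 ∨ (n : ℤ) - k + 1 ≤ x % n then (n : ℤ) else 0

theorem rotationLift_isAffinePerm {n k : ℕ} (hk : 2 ≤ k) (hkn : k + 2 ≤ n) :
    IsAffinePerm n (rotationLift n k) where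
  shift x := by
    unfold rotationLift
    rw [Int.add_emod_right]
    ring
  inj x y h := by
    unfold rotationLift at h
    split_ifs at h
    · convert h using 1; ring
    · rwa [← dvd_sub_self_right, show x - y - (n : ℤ) = x + k - n - (y + k - 0) by ring]
    · rwa [← dvd_add_self_right, show x - y + (n : ℤ) = x + k - 0 - (y + k - n) by ring]
    · convert h using 1; ring
  sum := by
    obtain ⟨p, hp⟩ : ∃ p, n = 2 + p + (k - 1) := ⟨n - 1 - k, by omega⟩
    rw [← sub_eq_zero, ← Finset.sum_sub_distrib]
    have h0 : ∀ j < n, rotationLift n k j - j = k - if j = 1 ∨ n - k + 1 ≤ j then (n : ℤ) else 0 := by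
      intro j hj
      unfold rotationLift
      rw [Int.emod_eq_of_lt (by omega) (by omega)]
      have : (((j : ℤ) = 1 ∨ (n : ℤ) - k + 1 ≤ j) ↔ (j = 1 ∨ n - k + 1 ≤ j)) := by omega
      simp only [this]
      ring
    have h1 : ∀ j ∈ Finset.range p, rotationLift n k ((2 + j : ℕ) : ℤ) - ((2 + j : ℕ) : ℤ) = k := by
      intro j hj
      have := Finset.mem_range.1 hj
      rw [h0 _ (by omega), if_neg (by omega), sub_zero]
    have h2 : ∀ j ∈ Finset.range (k - 1), rotationLift n k ((2 + p + j : ℕ) : ℤ)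
        - ((2 + p + j : ℕ) : ℤ) = k - n := by
      intro j hj
      have := Finset.mem_range.1 hj
      rw [h0 _ (by omega), if_pos (by omega)]
    have hrange : ∑ j ∈ Finset.range n, (rotationLift n k j - j) =
        ∑ j ∈ Finset.range (2 + p + (k - 1)), (rotationLift n k j - j) := by rw [← hp]
    rw [hrange, Finset.sum_range_add, Finset.sum_range_add, Finset.sum_congr rfl h1,
      Finset.sum_congr rfl h2, Finset.sum_range_succ, Finset.sum_range_one, h0 0 (by omega),
      h0 1 (by omega), if_neg (by omega), if_pos (by omega), Finset.sum_const, Finset.sum_const,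
      Finset.card_range, Finset.card_range]
    have hp' : (p : ℤ) = n - 1 - k := by omega
    simp only [nsmul_eq_mul, hp', Nat.cast_sub (by omega : 1 ≤ k)]
    push_cast
    ring

/-- Every cut of the word of `rotationLift` at a bond of the right parity leaves two positions
which are moved away from the cut. -/
theorem exists_two_outward {n k : ℕ} (hk : 2 ≤ k) (hkn : k + 2 ≤ n) (heven : (n : ℤ) % 2 = 0)
    (Q : ℤ → Prop) (hQ : ∀ i : ℤ, 0 ≤ i → i < n → (Q i ↔ i = 1 ∨ (n : ℤ) - k + 1 ≤ i))
    (hQ' : ∀ i, Q (i + n) ↔ Q i) {r z : ℤ} (hr : 0 ≤ r) (hrn : r < n) (hz : r - 1 ≤ z)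
    (hzr : z < r + n) (hpar : (z + k) % 2 = 1) :
    ∃ x y, r ≤ x ∧ x < y ∧ y < r + n ∧ (Q x ↔ x ≤ z) ∧ (Q y ↔ y ≤ z) := by
  have q0 : ¬ Q 0 := by rw [hQ 0 (by omega) (by omega)]; omega
  have q1 : Q 1 := by rw [hQ 1 (by omega) (by omega)]; omega
  have q2 : ¬ Q 2 := by rw [hQ 2 (by omega) (by omega)]; omega
  have qn : Q (n - 1) := by rw [hQ _ (by omega) (by omega)]; omega
  have q0n : ¬ Q n := by simpa using mt (hQ' 0).1 (by simpa using q0)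
  have q1n : Q (n + 1) := by rw [add_comm]; exact (hQ' 1).2 q1
  have q2n : ¬ Q (n + 2) := by rw [add_comm]; exact mt (hQ' 2).1 q2
  have qM : ∀ i : ℤ, 2 ≤ i → i < n - k + 1 → ¬ Q i := fun i h1 h2 => by
    rw [hQ i (by omega) (by omega)]; omega
  have qm : ∀ i, (n : ℤ) - k + 1 ≤ i → i < n → Q i := fun i h1 h2 => by
    rw [hQ i (by omega) (by omega)]; omega
  have yes : ∀ {x}, Q x → x ≤ z → (Q x ↔ x ≤ z) := fun h1 h2 => iff_of_true h1 h2
  have no : ∀ {x}, ¬ Q x → z < x → (Q x ↔ x ≤ z) := fun h1 h2 => iff_of_false h1 (not_le.2 h2)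
  rcases (by omega : r = 0 ∨ r = 1 ∨ r = 2 ∨ 3 ≤ r) with rfl | rfl | rfl | h3
  · rcases (by omega : z = -1 ∨ z = 0 ∨ z = 1 ∨ (2 ≤ z ∧ z < (n : ℤ) - k) ∨ ((n : ℤ) - k < z)) with
      h | h | h | h | h
    · exact ⟨0, 2, by omega, by omega, by omega, no q0 (by omega), no q2 (by omega)⟩
    · exact ⟨2, 3, by omega, by omega, by omega, no q2 (by omega),
        no (qM 3 (by omega) (by omega)) (by omega)⟩
    · exact ⟨1, 2, by omega, by omega, by omega, yes q1 (by omega), no q2 (by omega)⟩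
    · exact ⟨1, z + 1, by omega, by omega, by omega, yes q1 (by omega),
        no (qM _ (by omega) (by omega)) (by omega)⟩
    · exact ⟨1, z, by omega, by omega, by omega, yes q1 (by omega),
        yes (qm _ (by omega) (by omega)) (by omega)⟩
  · rcases (by omega : z = 0 ∨ (1 ≤ z ∧ z < n) ∨ z = n) with h | h | h
    · exact ⟨2, n, by omega, by omega, by omega, no q2 (by omega), no q0n (by omega)⟩
    · exact ⟨1, n, by omega, by omega, by omega, yes q1 (by omega), no q0n (by omega)⟩
    · exact ⟨1, n - 1, by omega, by omega, by omega, yes q1 (by omega), yes qn (by omega)⟩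
  · rcases (by omega : z = 1 ∨ (2 ≤ z ∧ z < (n : ℤ) - k) ∨ ((n : ℤ) - k < z ∧ z < n) ∨ z = n ∨ z = n + 1) with
      h | h | h | h | h
    · exact ⟨2, n, by omega, by omega, by omega, no q2 (by omega), no q0n (by omega)⟩
    · exact ⟨z + 1, n, by omega, by omega, by omega, no (qM _ (by omega) (by omega)) (by omega),
        no q0n (by omega)⟩
    · exact ⟨z, n, by omega, by omega, by omega, yes (qm _ (by omega) (by omega)) (by omega),
        no q0n (by omega)⟩
    · exact ⟨n - 2, n - 1, by omega, by omega, by omega,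
        yes (qm _ (by omega) (by omega)) (by omega), yes qn (by omega)⟩
    · exact ⟨n - 1, n + 1, by omega, by omega, by omega, yes qn (by omega), yes q1n (by omega)⟩
  · rcases (by omega : z ≤ n - 1 ∨ z = n ∨ n + 1 ≤ z) with h | h | h
    · exact ⟨n, n + 2, by omega, by omega, by omega, no q0n (by omega), no q2n (by omega)⟩
    · exact ⟨n - 1, n + 2, by omega, by omega, by omega, yes qn (by omega), no q2n (by omega)⟩
    · exact ⟨n - 1, n + 1, by omega, by omega, by omega, yes qn (by omega), yes q1n (by omega)⟩

/-- Moving back a contiguous block of `k` residues would give sums `n` and `n - 1` at adjacent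
bonds, spoiling both parities. Leaving residue `0` forward between backward ones ensures two zero
terms at every critical bond with `z + k` odd. -/
theorem rotationLift_parity {n k : ℕ} (hk : 2 ≤ k) (hkn : k + 2 ≤ n) (heven : Even n) {c z : ℤ}
    (hz : (z + k) % 2 = 1) (hzc : |z - c| ≤ ((n - 2 : ℕ) : ℤ)) :
    ∑ j ∈ Finset.range n, |cutTerm n (rotationLift n k) c z j| ≤ ((n - 2 : ℕ) : ℤ) := by
  have hd := rotationLift_isAffinePerm hk hkn
  have hn : 0 < n := by omega
  have hn' : (0 : ℤ) < n := by omega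
  rw [abs_le] at hzc
  have hc : ∀ x, c - rotationLift n k x = c - k - x +
      (if x % n = 1 ∨ (n : ℤ) - k + 1 ≤ x % n then (n : ℤ) else 0) := fun x => by
    unfold rotationLift; ring
  by_cases hlo : z < c - k
  · rw [hd.sum_abs_of_nonneg hn fun x => ?_]
    · omega
    · unfold cutTerm
      have := Int.ediv_le_ediv hn' (a := z - x) (b := c - rotationLift n k x)
        (by rw [hc]; split_ifs <;> omega)
      omega
  by_cases hhi : c - k + n < z
  · rw [hd.sum_abs_of_nonpos hn fun x => ?_]
    · omega
    · unfold cutTerm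
      have := Int.ediv_le_ediv hn' (b := z - x) (a := c - rotationLift n k x)
        (by rw [hc]; split_ifs <;> omega)
      omega
  -- On the window of length `n` from `w` both floors are `0` or `-1`, so a term vanishes exactly
  -- when being moved back agrees with lying left of the cut.
  obtain ⟨w, hw⟩ : ∃ w, w = c - k + 1 := ⟨_, rfl⟩
  have key : ∀ x, w ≤ x → x < w + n → cutTerm n (rotationLift n k) c z x =
      (if x % n = 1 ∨ (n : ℤ) - k + 1 ≤ x % n then 0 else -1) - if x ≤ z then 0 else -1 := by
    intro x h1 h2
    unfold cutTerm
    rw [hc]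
    congr 1
    · split_ifs
      · exact Int.ediv_eq_zero_of_lt (by omega) (by omega)
      · exact Int.ediv_eq_neg_one_of_neg (by omega) (by omega)
    · split_ifs
      · exact Int.ediv_eq_zero_of_lt (by omega) (by omega)
      · exact Int.ediv_eq_neg_one_of_neg (by omega) (by omega)
  have e1 := Int.mul_ediv_add_emod w n
  have e2 := Int.emod_nonneg w hn'.ne'
  have e3 := Int.emod_lt_of_pos w hn'
  obtain ⟨o, ho⟩ : ∃ o, o = (n : ℤ) * (w / n) := ⟨_, rfl⟩
  rw [← ho] at e1
  have hoe : o % 2 = 0 := by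
    obtain ⟨m, hm⟩ := heven
    have : o = 2 * (m * (w / n)) := by
      rw [ho, ← mul_assoc]
      congr 1
      omega
    omega
  have hmod : ∀ i, (o + i) % n = i % n := fun i => by rw [ho, Int.mul_add_emod_self_left]
  obtain ⟨x, y, hx, hxy, hy, qx, qy⟩ := exists_two_outward hk hkn
    (by obtain ⟨m, hm⟩ := heven; omega)
    (fun i : ℤ => i % n = 1 ∨ (n : ℤ) - k + 1 ≤ i % n)
    (fun i h1 h2 => by rw [Int.emod_eq_of_lt h1 h2]) (fun i => by rw [Int.add_emod_right])
    e2 e3 (z := z - o) (by omega) (by omega) (by omega)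
  have hzero : ∀ i, w % n ≤ i → i < w % n + n →
      ((i % n = 1 ∨ (n : ℤ) - k + 1 ≤ i % n) ↔ i ≤ z - o) →
      cutTerm n (rotationLift n k) c z (o + i) = 0 := by
    intro i h1 h2 h3
    rw [key _ (by omega) (by omega), hmod]
    simp only [h3]
    split_ifs <;> omega
  have hsum := sum_abs_add_two_le (n := n) (fun j => cutTerm n (rotationLift n k) c z (w + j))
    (fun j hj => by rw [key _ (by omega) (by omega)]; split_ifs <;> simp)
    (i := (x - w % n).toNat) (k := (y - w % n).toNat) (by omega) (by omega) (by omega)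
    (by rw [show w + (((x - w % n).toNat : ℕ) : ℤ) = o + x by omega]
        exact hzero x (by omega) (by omega) qx)
    (by rw [show w + (((y - w % n).toNat : ℕ) : ℤ) = o + y by omega]
        exact hzero y (by omega) (by omega) qy)
  have hper := sum_range_periodic (n := n) (fun x => |cutTerm n (rotationLift n k) c z x|)
    (fun x => by rw [hd.cutTerm_shift hn]) w
  omega

/-! ### Choice of the displacements. -/

/-- Minimise `∑ (K * s i ^ 2 + φ i * s i)` with `K` above every `|φ i|`. Transferring `n` from `i`
to `j` cannot decrease it; the quadratic part dominates and bounds the spread, and at equality the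
linear part compares `φ`. -/
theorem exists_balanced_displacement {ι : Type*} [Fintype ι] [DecidableEq ι] {n : ℤ} (hn : 0 < n)
    (s₀ : ι → ℤ) (hs₀ : ∑ i, s₀ i = 0) (φ : ι → ℤ) :
    ∃ s : ι → ℤ, (∀ i, n ∣ s i - s₀ i) ∧ ∑ i, s i = 0 ∧ (∀ i j, s i - s j ≤ n) ∧
      ∀ i j, s i - s j = n → φ i ≤ φ j := by
  obtain ⟨K, hK⟩ : ∃ K : ℤ, ∀ i, |φ i| < K :=
    ⟨∑ i, |φ i| + 1, fun i => Int.lt_add_one_of_le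
      (Finset.single_le_sum (f := fun i => |φ i|) (fun _ _ => abs_nonneg _) (Finset.mem_univ i))⟩
  obtain ⟨Φ, hΦ⟩ : ∃ Φ : (ι → ℤ) → ℤ, Φ = fun s => ∑ i, (K * s i ^ 2 + φ i * s i) := ⟨_, rfl⟩
  have hΦ0 : ∀ s, 0 ≤ Φ s := by
    intro s
    rw [hΦ]
    refine Finset.sum_nonneg fun i _ => ?_
    have h1 : |φ i * s i| ≤ K * s i ^ 2 := by
      rw [abs_mul, ← sq_abs (s i)]
      have := hK i
      have : 0 ≤ |φ i| := abs_nonneg _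
      have : |s i| ≤ |s i| ^ 2 := by
        rcases (abs_nonneg (s i)).eq_or_lt with h | h
        · simp [← h]
        · nlinarith
      nlinarith [abs_nonneg (s i)]
    linarith [neg_abs_le (φ i * s i)]
  obtain ⟨s, ⟨hs1, hs2⟩, hmin⟩ := WellFounded.has_min
    (InvImage.wf (fun s => (Φ s).toNat) Nat.lt_wfRel.wf)
    {s | (∀ i, n ∣ s i - s₀ i) ∧ ∑ i, s i = 0} ⟨s₀, by simp, hs₀⟩
  have hmin' : ∀ i j, i ≠ j → 0 ≤ 2 * K * (n - (s i - s j)) + (φ j - φ i) := by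
    intro i j hij
    obtain ⟨s', hs'⟩ : ∃ s' : ι → ℤ, s' = s - Pi.single i n + Pi.single j n := ⟨_, rfl⟩
    have hs'mem : s' ∈ {s : ι → ℤ | (∀ i, n ∣ s i - s₀ i) ∧ ∑ i, s i = 0} := by
      refine ⟨fun k => ?_, ?_⟩
      · have : s' k - s₀ k = (s k - s₀ k) - (Pi.single i n : ι → ℤ) k
            + (Pi.single j n : ι → ℤ) k := by
          rw [hs']; simp only [Pi.add_apply, Pi.sub_apply]; ring
        rw [this]
        refine dvd_add (dvd_sub (hs1 k) ?_) ?_ <;> (rw [Pi.single_apply]; split_ifs <;> simp)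
      · rw [hs']
        simp [Finset.sum_add_distrib, Finset.sum_sub_distrib, hs2]
    have h1 : Φ s ≤ Φ s' := by
      have := hmin s' hs'mem
      change ¬ (Φ s').toNat < (Φ s).toNat at this
      have := hΦ0 s
      have := hΦ0 s'
      omega
    have h2 : Φ s' - Φ s = n * (2 * K * (n - (s i - s j)) + (φ j - φ i)) := by
      rw [hΦ]
      simp only
      rw [← Finset.sum_sub_distrib, Fintype.sum_eq_add i j hij]
      · simp [hs', hij, hij.symm]
        ring
      · rintro k ⟨hki, hkj⟩
        simp [hs', hki, hkj]
    exact nonneg_of_mul_nonneg_right (by linarith) hn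
  refine ⟨s, hs1, hs2, fun i j => ?_, fun i j h => ?_⟩
  · by_cases hij : i = j
    · subst hij; simp [hn.le]
    · by_contra! hlt
      have h1 := hmin' i j hij
      have h2 := abs_lt.1 (hK i)
      have h3 := abs_lt.1 (hK j)
      nlinarith
  · have hij : i ≠ j := by rintro rfl; omega
    have h1 := hmin' i j hij
    rw [h] at h1
    linarith

/-! ### From sorting on `ℤ` to routing on the cycle. -/

theorem isMatchingSwap_of_involutive {V : Type*} {G : SimpleGraph V} {σ : Equiv.Perm V}
    (hσ : Function.Involutive σ) (h : ∀ v, σ v ≠ v → G.Adj v (σ v)) : IsMatchingSwap G σ := by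
  refine ⟨{ verts := {v | σ v ≠ v}, Adj := fun u v => σ u = v ∧ u ≠ v, adj_sub := ?_,
            edge_vert := ?_, symm := ?_ }, ?_, fun u v huv => huv.1, fun v hv => not_not.1 hv⟩
  · rintro u v ⟨rfl, huv⟩
    exact h u huv.symm
  · rintro u v ⟨rfl, huv⟩
    exact huv.symm
  · exact ⟨by rintro u v ⟨rfl, huv⟩; exact ⟨hσ u, huv.symm⟩⟩
  · intro v hv
    exact ⟨σ v, ⟨rfl, Ne.symm hv⟩, fun w hw => hw.1.symm⟩

/-- The vertex of the `n`-cycle below the integer `x`. -/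
def cycleVertex (n : ℕ) [NeZero n] (x : ℤ) : Fin n :=
  ⟨(x % n).toNat, by
    have hn : (0 : ℤ) < n := by exact_mod_cast Nat.pos_of_ne_zero (NeZero.ne n)
    have := Int.emod_lt_of_pos x hn
    have := Int.emod_nonneg x hn.ne'
    omega⟩

section CycleVertex

variable {n : ℕ} [NeZero n]

theorem cycleVertex_val (x : ℤ) : ((cycleVertex n x : ℕ) : ℤ) = x % n :=
  Int.toNat_of_nonneg (Int.emod_nonneg x (by exact_mod_cast NeZero.ne n))

theorem cycleVertex_eq_iff {x y : ℤ} : cycleVertex n x = cycleVertex n y ↔ (n : ℤ) ∣ x - y := by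
  rw [Fin.ext_iff, ← Int.natCast_inj, cycleVertex_val, cycleVertex_val,
    Int.emod_eq_emod_iff_emod_sub_eq_zero, Int.dvd_iff_emod_eq_zero]

theorem cycleVertex_coe (i : Fin n) : cycleVertex n ((i : ℕ) : ℤ) = i := by
  rw [Fin.ext_iff, ← Int.natCast_inj, cycleVertex_val]
  exact Int.emod_eq_of_lt (by omega) (by have := i.2; omega)

theorem cycleVertex_add_one (x : ℤ) : cycleVertex n (x + 1) = cycleVertex n x + 1 := by
  rw [Fin.ext_iff, ← Int.natCast_inj, cycleVertex_val, Fin.val_add, Int.natCast_mod, Nat.cast_add,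
    cycleVertex_val, Fin.val_one', Int.natCast_mod, Nat.cast_one, ← Int.add_emod]

theorem cycleVertex_add_self (x : ℤ) : cycleVertex n (x + n) = cycleVertex n x :=
  cycleVertex_eq_iff.2 (by simp)

theorem cycleGraph_adj_cycleVertex (hn : 2 ≤ n) (x : ℤ) :
    (SimpleGraph.cycleGraph n).Adj (cycleVertex n x) (cycleVertex n (x + 1)) := by
  rw [SimpleGraph.cycleGraph_adj', cycleVertex_add_one, add_sub_cancel_left, Fin.val_one',
    Nat.mod_eq_of_lt (by omega)]
  exact Or.inr rfl

end CycleVertex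

/-- The position from which the value at `x` after round `t` of `oddEvenSort` has come. -/
def sortSource (ε : ℤ) (d : ℤ → ℤ) (t : ℕ) (x : ℤ) : ℤ :=
  if (x + t + ε) % 2 = 0 then
    if oddEvenSort ε d t (x + 1) < oddEvenSort ε d t x then x + 1 else x
  else if oddEvenSort ε d t x < oddEvenSort ε d t (x - 1) then x - 1 else x

theorem oddEvenSort_sortSource (ε : ℤ) (d : ℤ → ℤ) (t : ℕ) (x : ℤ) :
    oddEvenSort ε d t (sortSource ε d t x) = oddEvenSort ε d (t + 1) x := by
  unfold sortSource
  split_ifs with h h1 h1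
  · rw [oddEvenSort_succ_left h, min_eq_right h1.le]
  · rw [oddEvenSort_succ_left h, min_eq_left (not_lt.1 h1)]
  · rw [oddEvenSort_succ_right h, max_eq_left h1.le]
  · rw [oddEvenSort_succ_right h, max_eq_right (not_lt.1 h1)]

theorem sortSource_sortSource (ε : ℤ) (d : ℤ → ℤ) (t : ℕ) (x : ℤ) :
    sortSource ε d t (sortSource ε d t x) = x := by
  by_cases h : (x + t + ε) % 2 = 0
  · by_cases h1 : oddEvenSort ε d t (x + 1) < oddEvenSort ε d t x
    · have e : sortSource ε d t x = x + 1 := by simp [sortSource, h, h1]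
      have h' : ¬ (x + 1 + t + ε) % 2 = 0 := by omega
      rw [e]
      simp [sortSource, h', h1]
    · have e : sortSource ε d t x = x := by simp [sortSource, h, h1]
      rw [e, e]
  · by_cases h1 : oddEvenSort ε d t x < oddEvenSort ε d t (x - 1)
    · have e : sortSource ε d t x = x - 1 := by simp [sortSource, h, h1]
      have h' : (x - 1 + t + ε) % 2 = 0 := by omega
      rw [e]
      simp [sortSource, h', h1]
    · have e : sortSource ε d t x = x := by simp [sortSource, h, h1]
      rw [e, e]

theorem oddEvenSort_shift {n : ℕ} {d : ℤ → ℤ} (hd : ∀ x, d (x + n) = d x + n)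
    (heven : (n : ℤ) % 2 = 0) (ε : ℤ) (t : ℕ) (x : ℤ) :
    oddEvenSort ε d t (x + n) = oddEvenSort ε d t x + n := by
  induction t generalizing x with
  | zero => exact hd x
  | succ t ih =>
    have h1 := ih (x + 1)
    have h2 := ih (x - 1)
    rw [show x + 1 + n = x + n + 1 by ring] at h1
    rw [show x - 1 + n = x + n - 1 by ring] at h2
    by_cases h : (x + t + ε) % 2 = 0
    · rw [oddEvenSort_succ_left h, oddEvenSort_succ_left (by omega), ih, h1]
      omega
    · rw [oddEvenSort_succ_right h, oddEvenSort_succ_right (by omega), ih, h2]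
      omega

theorem sortSource_shift {n : ℕ} {d : ℤ → ℤ} (hd : ∀ x, d (x + n) = d x + n)
    (heven : (n : ℤ) % 2 = 0) (ε : ℤ) (t : ℕ) (x : ℤ) :
    sortSource ε d t (x + n) = sortSource ε d t x + n := by
  have h0 := oddEvenSort_shift hd heven ε t x
  have h1 := oddEvenSort_shift hd heven ε t (x + 1)
  have h2 := oddEvenSort_shift hd heven ε t (x - 1)
  rw [show x + 1 + n = x + n + 1 by ring] at h1
  rw [show x - 1 + n = x + n - 1 by ring] at h2
  unfold sortSource
  rw [h0, h1, h2]
  split_ifs <;> omega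

section Routing

variable {n : ℕ} [NeZero n]

/-- The permutation of the vertices of the cycle effected in round `t` of `oddEvenSort`. -/
def sortSwap (n : ℕ) [NeZero n] (ε : ℤ) (d : ℤ → ℤ) (t : ℕ) (i : Fin n) : Fin n :=
  cycleVertex n (sortSource ε d t (i : ℕ))

theorem sortSwap_cycleVertex {d : ℤ → ℤ} (hd : ∀ x, d (x + n) = d x + n)
    (heven : (n : ℤ) % 2 = 0) (ε : ℤ) (t : ℕ) (x : ℤ) :
    sortSwap n ε d t (cycleVertex n x) = cycleVertex n (sortSource ε d t x) := by
  have hmul : ∀ (y j : ℤ), sortSource ε d t (y + n * j) = sortSource ε d t y + n * j := by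
    intro y j
    induction j using Int.induction_on with
    | zero => simp
    | succ i ih =>
      rw [show y + n * ((i : ℤ) + 1) = y + n * i + n by ring, sortSource_shift hd heven, ih]
      ring
    | pred i ih =>
      have := sortSource_shift hd heven ε t (y + n * (-(i : ℤ) - 1))
      rw [show y + n * (-(i : ℤ) - 1) + n = y + n * (-i) by ring, ih] at this
      linarith
  unfold sortSwap
  rw [cycleVertex_val, cycleVertex_eq_iff]
  have h := hmul (x % n) (x / n)
  rw [Int.emod_add_mul_ediv] at h
  rw [h]
  exact ⟨-(x / n), by ring⟩

theorem sortSwap_involutive {d : ℤ → ℤ} (hd : ∀ x, d (x + n) = d x + n)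
    (heven : (n : ℤ) % 2 = 0) (ε : ℤ) (t : ℕ) : Function.Involutive (sortSwap n ε d t) := by
  intro i
  conv_lhs => rw [← cycleVertex_coe i]
  rw [sortSwap_cycleVertex hd heven, sortSwap_cycleVertex hd heven, sortSource_sortSource,
    cycleVertex_coe]

theorem sortSwap_adj (hn : 2 ≤ n) (ε : ℤ) (d : ℤ → ℤ) (t : ℕ) (i : Fin n)
    (hi : sortSwap n ε d t i ≠ i) : (SimpleGraph.cycleGraph n).Adj i (sortSwap n ε d t i) := by
  have hc := cycleVertex_coe i
  unfold sortSwap sortSource at hi ⊢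
  split_ifs at hi ⊢
  · have := cycleGraph_adj_cycleVertex hn (i : ℕ)
    rwa [hc] at this
  · exact absurd hc hi
  · have := cycleGraph_adj_cycleVertex hn ((i : ℕ) - 1)
    rw [sub_add_cancel, hc] at this
    exact this.symm
  · exact absurd hc hi

theorem routesIn_of_oddEvenSort (hn : 2 ≤ n) (heven : (n : ℤ) % 2 = 0) (π : Equiv.Perm (Fin n))
    {d : ℤ → ℤ} (hd : ∀ x, d (x + n) = d x + n)
    (hπ : ∀ x, cycleVertex n (d x) = π⁻¹ (cycleVertex n x)) (ε : ℤ) (T : ℕ)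
    (hT : ∀ x, oddEvenSort ε d T x = x) : RoutesIn (SimpleGraph.cycleGraph n) π T := by
  obtain ⟨σ, hσ⟩ : ∃ σ : ℕ → Equiv.Perm (Fin n), ∀ t i, σ t i = sortSwap n ε d t i :=
    ⟨fun t => (sortSwap_involutive hd heven ε t).toPerm, fun _ _ => rfl⟩
  have hinv : ∀ t, Function.Involutive (σ t) := fun t i => by
    rw [hσ, hσ, sortSwap_involutive hd heven]
  obtain ⟨p, hp0, hp⟩ : ∃ p : ℕ → Equiv.Perm (Fin n), p 0 = π ∧ ∀ t, p (t + 1) = σ t * p t :=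
    ⟨fun t => Nat.rec π (fun t q => σ t * q) t, rfl, fun _ => rfl⟩
  -- Invariant: the sorted value above a vertex reduces modulo `n` to the destination of the pebble
  -- there.
  have key : ∀ t x i, cycleVertex n x = p t i → cycleVertex n (oddEvenSort ε d t x) = i := by
    intro t
    induction t with
    | zero =>
      intro x i hx
      change cycleVertex n (d x) = i
      rw [hπ, hx, hp0]
      exact π.symm_apply_apply i
    | succ t ih =>
      intro x i hx
      rw [← oddEvenSort_sortSource]
      apply ih
      rw [← sortSwap_cycleVertex hd heven, hx, hp, Equiv.Perm.mul_apply, ← hσ, hinv]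
  refine ⟨p, hp0, fun t _ => ⟨σ t, ?_, fun i => by rw [hp]; rfl⟩, fun i => ?_⟩
  · refine isMatchingSwap_of_involutive (hinv t) fun v hv => ?_
    rw [hσ] at hv ⊢
    exact sortSwap_adj hn ε d t v hv
  · have := key T ((p T i : ℕ) : ℤ) i (cycleVertex_coe _)
    rwa [hT, cycleVertex_coe] at this

theorem routesIn_of_isAffinePerm (hn : 6 ≤ n) (heven : Even n) (π : Equiv.Perm (Fin n))
    {d : ℤ → ℤ} (hd : IsAffinePerm n d)
    (hπ : ∀ x, cycleVertex n (d x) = π⁻¹ (cycleVertex n x)) (ε : ℤ)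
    (h : ∀ c z, (z + ε) % 2 = 1 → |z - c| ≤ ((n - 2 : ℕ) : ℤ) →
      ∑ j ∈ Finset.range n, |cutTerm n d c z j| ≤ ((n - 2 : ℕ) : ℤ)) :
    RoutesIn (SimpleGraph.cycleGraph n) π (n - 2) :=
  routesIn_of_oddEvenSort (by omega) (by obtain ⟨m, hm⟩ := heven; omega) π hd.shift hπ ε _
    (hd.oddEvenSort_eq_id (by omega) ε (n - 2) (by omega) h)

end Routing

/-! ### Non-rotations, rotations and the conclusion. -/

/-- Breaks depend only on displacements modulo `n`, so the tie-breaking function can be read off the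
naive lift `d₀` before the balanced lift is chosen. -/
theorem routesIn_of_exists_isBreak {n : ℕ} [NeZero n] (hn : 6 ≤ n) (heven : Even n)
    (π : Equiv.Perm (Fin n))
    (hbreak : ∃ x, IsBreak n (fun x => x + ((π⁻¹ (cycleVertex n x) : ℕ) - (cycleVertex n x : ℕ))) x) :
    RoutesIn (SimpleGraph.cycleGraph n) π (n - 2) := by
  obtain ⟨d₀, hd₀⟩ : ∃ d₀ : ℤ → ℤ,
      d₀ = fun x => x + ((π⁻¹ (cycleVertex n x) : ℕ) - (cycleVertex n x : ℕ)) := ⟨_, rfl⟩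
  rw [← hd₀] at hbreak
  have hn' : (0 : ℤ) < n := by omega
  obtain ⟨s, hs1, hs2, hs3, hs4⟩ := exists_balanced_displacement hn'
    (fun i : Fin n => (((π⁻¹ i : Fin n) : ℕ) : ℤ) - ((i : ℕ) : ℤ))
    (by rw [Finset.sum_sub_distrib, Equiv.sum_comp π⁻¹ (fun i : Fin n => ((i : ℕ) : ℤ)), sub_self])
    (fun i => runHeight (IsBreak n d₀) (i : ℕ))
  obtain ⟨d, hdef⟩ : ∃ d : ℤ → ℤ, ∀ x, d x = x + s (cycleVertex n x) := ⟨_, fun _ => rfl⟩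
  have hdd₀ : ∀ x, (n : ℤ) ∣ d x - d₀ x := fun x => by
    rw [hdef, hd₀, add_sub_add_left_eq_sub]
    exact hs1 _
  have hπ : ∀ x, cycleVertex n (d x) = π⁻¹ (cycleVertex n x) := fun x => by
    rw [← cycleVertex_coe (π⁻¹ (cycleVertex n x)), cycleVertex_eq_iff]
    have h1 := hdd₀ x
    have h2 := Int.mul_ediv_add_emod x n
    rw [← cycleVertex_val] at h2
    have h3 : d x - ((π⁻¹ (cycleVertex n x) : ℕ) : ℤ) = (d x - d₀ x) + n * (x / n) := by
      rw [hd₀]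
      linarith
    rw [h3]
    exact dvd_add h1 (dvd_mul_right _ _)
  have hd : IsAffinePerm n d :=
    { shift := fun x => by rw [hdef, hdef, cycleVertex_add_self]; ring
      inj := fun x y h => by
        rw [← cycleVertex_eq_iff, hπ, hπ] at h
        exact cycleVertex_eq_iff.1 (π⁻¹.injective h)
      sum := by
        rw [← Fin.sum_univ_eq_sum_range (fun j : ℕ => d j), ← Fin.sum_univ_eq_sum_range]
        simp only [hdef, cycleVertex_coe, Finset.sum_add_distrib, hs2, add_zero] }
  have hbr : IsBreak n d = IsBreak n d₀ := by
    ext x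
    unfold IsBreak
    have h1 := dvd_sub (hdd₀ (x + 1)) (hdd₀ x)
    rw [dvd_iff_dvd_of_dvd_sub (a := (n : ℤ)) (b := d (x + 1) - d x - 1)
      (c := d₀ (x + 1) - d₀ x - 1)]
    convert h1 using 1
    ring
  have hper : ∀ x, runHeight (IsBreak n d) ((cycleVertex n x : ℕ) : ℤ) = runHeight (IsBreak n d) x := by
    intro x
    have h1 : Function.Periodic (runHeight (IsBreak n d)) (n : ℤ) := fun z => by
      unfold runHeight
      rw [forwardRun_add_period hd.isBreak_shift, backRun_add_period hd.isBreak_shift]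
    have h2 := h1.int_mul (x / n) (x % n)
    rw [cycleVertex_val, ← h2]
    congr 1
    rw [mul_comm]
    exact Int.emod_add_mul_ediv x n
  have hdisp : ∀ x, d x - x = s (cycleVertex n x) := fun x => by rw [hdef]; ring
  obtain ⟨ε, hε⟩ := hd.exists_parity hn heven
    (fun x y => by rw [hdisp, hdisp]; exact hs3 _ _) (by rwa [hbr])
    (fun x y hxy => by
      rw [hdisp, hdisp] at hxy
      rw [← hper x, ← hper y, hbr]
      exact hs4 _ _ hxy)
  exact routesIn_of_isAffinePerm hn heven π hd hπ ε hε

/-- Without breaks `π⁻¹` commutes with the unit rotation, so it is determined by its value at `0`.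
-/
theorem exists_inv_eq_rotation {n : ℕ} [NeZero n] (π : Equiv.Perm (Fin n))
    (hbreak : ¬ ∃ x, IsBreak n
      (fun x => x + ((π⁻¹ (cycleVertex n x) : ℕ) - (cycleVertex n x : ℕ))) x) :
    ∃ k < n, ∀ x, π⁻¹ (cycleVertex n x) = cycleVertex n (x + k) := by
  push Not at hbreak
  have hstep : ∀ x : ℤ, π⁻¹ (cycleVertex n (x + 1)) = π⁻¹ (cycleVertex n x) + 1 := by
    intro x
    have h1 := not_not.1 (hbreak x)
    beta_reduce at h1
    rw [← cycleVertex_coe (π⁻¹ (cycleVertex n (x + 1))), ← cycleVertex_coe (π⁻¹ (cycleVertex n x)),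
      ← cycleVertex_add_one, cycleVertex_eq_iff]
    have h2 : (n : ℤ) ∣ (cycleVertex n (x + 1) : ℕ) - ((cycleVertex n x : ℕ) + 1) := by
      rw [← cycleVertex_eq_iff, cycleVertex_add_one, cycleVertex_add_one, cycleVertex_coe,
        cycleVertex_coe]
    obtain ⟨w, hw⟩ := dvd_add h1 h2
    exact ⟨w, by linarith⟩
  refine ⟨(π⁻¹ (cycleVertex n 0) : ℕ), (π⁻¹ (cycleVertex n 0)).2, fun x => ?_⟩
  induction x using Int.induction_on with
  | zero => rw [zero_add, cycleVertex_coe]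
  | succ i ih => rw [hstep, ih, ← cycleVertex_add_one, add_right_comm]
  | pred i ih =>
    have h1 := hstep (-(i : ℤ) - 1)
    rw [sub_add_cancel, ih, ← sub_eq_iff_eq_add] at h1
    rw [← h1, sub_eq_iff_eq_add, ← cycleVertex_add_one]
    congr 1
    ring

theorem theorem2 (n : ℕ) (hn : 6 ≤ n) (heven : Even n) (π : Equiv.Perm (Fin n))
    (hrt : routingNumber (SimpleGraph.cycleGraph n) π = ((n - 1 : ℕ) : ℕ∞)) :
    π = finRotate n ∨ π = (finRotate n)⁻¹ := by
  have : NeZero n := ⟨by omega⟩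
  have hno : ∀ k, k ≤ n - 2 → ¬ RoutesIn (SimpleGraph.cycleGraph n) π k := by
    intro k hk hr
    have h1 : routingNumber (SimpleGraph.cycleGraph n) π ≤ (k : ℕ∞) := iInf₂_le k hr
    rw [hrt] at h1
    have := Nat.cast_le.1 h1
    omega
  obtain ⟨k, hkn, hk⟩ := exists_inv_eq_rotation π
    (fun h => hno (n - 2) le_rfl (routesIn_of_exists_isBreak hn heven π h))
  have hrot : ∀ i, finRotate n i = cycleVertex n ((i : ℕ) + 1) := fun i => by
    rw [finRotate_apply, cycleVertex_add_one, cycleVertex_coe]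
  by_cases h0 : k = 0
  · refine absurd ⟨fun _ => π, rfl, fun t ht => absurd ht (by omega), fun i => ?_⟩
      (hno 0 (by omega))
    have := hk (i : ℕ)
    rw [h0, cycleVertex_coe, Nat.cast_zero, add_zero, cycleVertex_coe] at this
    exact (Equiv.Perm.inv_eq_iff_eq.1 this).symm
  by_cases h1 : k = 1
  · right
    rw [← inv_eq_iff_eq_inv]
    ext i : 1
    have := hk (i : ℕ)
    rw [hrot, ← cycleVertex_coe i, this, h1, cycleVertex_coe]
    simp
  by_cases h2 : k = n - 1
  · left
    rw [← inv_inj]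
    ext i : 1
    have := hk (i : ℕ)
    rw [cycleVertex_coe] at this
    rw [this, eq_comm, Equiv.Perm.inv_eq_iff_eq, finRotate_apply, ← cycleVertex_add_one, h2,
      show ((i : ℕ) : ℤ) + ((n - 1 : ℕ) : ℤ) + 1 = (i : ℕ) + n by omega, cycleVertex_add_self,
      cycleVertex_coe]
  · have hd := rotationLift_isAffinePerm (n := n) (k := k) (by omega) (by omega)
    refine absurd (routesIn_of_isAffinePerm hn heven π hd (fun x => ?_) k fun c z hz hzc =>
      rotationLift_parity (by omega) (by omega) heven hz hzc) (hno (n - 2) le_rfl)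
    rw [hk, cycleVertex_eq_iff]
    unfold rotationLift
    split_ifs <;> simp
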